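/- Let $\Gamma$ be a finite simple graph, and let $A_\Gamma=\langle g_v\ (v\in V(\Gamma)) \mid g_vg_w=g_wg_v \text{ whenever } v,w \text{ are adjacent}\rangle$ be the associated right-angled Artin group. Then there is an integer $n\ge 1$, depending only on $\Gamma$, such that every finite extension of $A_\Gamma$, i.e. every group $G$ having a finite-index subgroup isomorphic to $A_\Gamma$ (normal or not), embeds into the Brin–Thompson group $nV$. Here $nV$ is the group, under composition, of all homeomorphisms $h$ of the Cantor cube $X=(\{0,1\}^\omega)^n$ for which there are partitions $D_1,\dots,D_k$ and $R_1,\dots,R_k$ of $X$ into finitely many subcubes such that $h$ maps each $D_j$ onto $R_j$ by prefix replacement. A subcube is a set of the form $X(\alpha_1,\dots,\alpha_n)=\{(\alpha_1\cdot x_1,\dots,\alpha_n\cdot x_n) : x\in X\}$ with $\alpha_1,\dots,\alpha_n$ finite binary words, and prefix replacement from $X(\alpha_1,\dots,\alpha_n)$ to $X(\beta_1,\dots,\beta_n)$ is the map $(\alpha_1\cdot x_1,\dots,\alpha_n\cdot x_n)\mapsto(\beta_1\cdot x_1,\dots,\beta_n\cdot x_n)$. -/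

import Mathlib

/-! ### Right-angled Artin groups -/

/-- The defining relators of the right-angled Artin group of `Γ`: one commutator `[g_v, g_w]` for
each pair of adjacent vertices `v`, `w`. -/
def raagRels {V : Type*} (Γ : SimpleGraph V) : Set (FreeGroup V) :=
  {r | ∃ v w : V, Γ.Adj v w ∧
    r = FreeGroup.of v * FreeGroup.of w * (FreeGroup.of v)⁻¹ * (FreeGroup.of w)⁻¹}

/-- The right-angled Artin group `A_Γ = ⟨g_v (v ∈ V) | g_v g_w = g_w g_v for v, w adjacent⟩`. -/
abbrev RightAngledArtinGroup {V : Type*} (Γ : SimpleGraph V) : Type _ :=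
  PresentedGroup (raagRels Γ)

/-- `G` is a finite extension of `A`: `G` contains a copy of `A` as a subgroup of finite index.
The copy may or may not be normal; in particular this covers every group `G` in a short exact
sequence `1 → A → G → F → 1` with `F` finite. -/
def IsFiniteExtension (A G : Type*) [Group A] [Group G] : Prop :=
  ∃ i : A →* G, Function.Injective i ∧ i.range.FiniteIndex

/-- `G` embeds (as a group) into `H`. -/
def GroupEmbeds (G H : Type*) [Group G] [Group H] : Prop :=
  ∃ f : G →* H, Function.Injective f

/-! ### The Brin–Thompson groups -/

/-- The concatenation `a · x` of a finite binary string `a` and an infinite binary string `x`. -/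
def prependWord : List Bool → (ℕ → Bool) → ℕ → Bool
  | [], x => x
  | b :: a, x => fun k => Nat.casesOn k b (prependWord a x)

/-- The Cantor cube `({0,1}^ω)^n`; its topology is the product topology. -/
abbrev CantorCube (n : ℕ) : Type := Fin n → ℕ → Bool

/-- The map `(x_1, …, x_n) ↦ (α_1 · x_1, …, α_n · x_n)`. -/
def cubeMap {n : ℕ} (α : Fin n → List Bool) (x : CantorCube n) : CantorCube n :=
  fun i => prependWord (α i) (x i)

/-- The subcube `X(α_1, …, α_n)`: all points whose `i`-th coordinate begins with `α_i`. -/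
def subcube {n : ℕ} (α : Fin n → List Bool) : Set (CantorCube n) :=
  Set.range (cubeMap α)

/-- The subcubes with addresses `D j` partition the Cantor cube: each point lies in exactly one. -/
def IsCubePartition {n : ℕ} {ι : Type*} (D : ι → Fin n → List Bool) : Prop :=
  ∀ x : CantorCube n, ∃! j : ι, x ∈ subcube (D j)

/-- A homeomorphism of the Cantor cube is a rearrangement if there are partitions
`D_1, …, D_k` and `R_1, …, R_k` of the cube into finitely many subcubes such that it maps each
`D_j` to `R_j` by the canonical homeomorphism (prefix replacement). -/
def IsRearrangement {n : ℕ} (h : CantorCube n ≃ₜ CantorCube n) : Prop :=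
  ∃ (k : ℕ) (D R : Fin k → Fin n → List Bool),
    IsCubePartition D ∧ IsCubePartition R ∧
      ∀ (j : Fin k) (x : CantorCube n), h (cubeMap (D j) x) = cubeMap (R j) x

theorem prependWord_injective (a : List Bool) : Function.Injective (prependWord a) := by
  induction a with
  | nil => exact fun _ _ h => h
  | cons b a ih =>
    intro x y h
    apply ih
    funext k
    exact congrFun h (k + 1)

theorem prependWord_append (a b : List Bool) (x : ℕ → Bool) :
    prependWord (a ++ b) x = prependWord a (prependWord b x) := by
  induction a with
  | nil => rfl
  | cons c a ih => simp only [List.cons_append, prependWord, ih]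

theorem cubeMap_append {n : ℕ} (α β : Fin n → List Bool) (x : CantorCube n) :
    cubeMap (fun i => α i ++ β i) x = cubeMap α (cubeMap β x) := by
  funext i
  exact prependWord_append _ _ _

theorem prependWord_overlap (a b : List Bool) (x y : ℕ → Bool)
    (h : prependWord a x = prependWord b y) :
    a ++ b.drop a.length = b ++ a.drop b.length ∧
      ∃ z, x = prependWord (b.drop a.length) z ∧ y = prependWord (a.drop b.length) z := by
  induction a generalizing b with
  | nil => exact ⟨by simp, y, by simpa [prependWord] using h, by simp [prependWord]⟩
  | cons c a ih =>
    cases b with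
    | nil => exact ⟨by simp, x, by simp [prependWord], by simpa [prependWord] using h.symm⟩
    | cons d b =>
      have h0 : c = d := congrFun h 0
      have h1 : prependWord a x = prependWord b y := by
        funext k
        exact congrFun h (k + 1)
      obtain ⟨h2, z, hx, hy⟩ := ih b h1
      refine ⟨by simpa [h0] using h2, z, by simpa using hx, by simpa using hy⟩

theorem cubeMap_overlap {n : ℕ} (α β : Fin n → List Bool) (x y : CantorCube n)
    (h : cubeMap α x = cubeMap β y) :
    (∀ i, α i ++ (β i).drop (α i).length = β i ++ (α i).drop (β i).length) ∧
      ∃ z, x = cubeMap (fun i => (β i).drop (α i).length) z ∧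
        y = cubeMap (fun i => (α i).drop (β i).length) z := by
  have key := fun i => prependWord_overlap (α i) (β i) (x i) (y i) (congrFun h i)
  choose h1 z hx hy using key
  exact ⟨h1, z, funext hx, funext hy⟩

theorem mem_subcube_iff_of_map {n : ℕ} (h : CantorCube n ≃ₜ CantorCube n)
    (α β : Fin n → List Bool) (hab : ∀ x, h (cubeMap α x) = cubeMap β x) (y : CantorCube n) :
    h y ∈ subcube β ↔ y ∈ subcube α := by
  constructor
  · rintro ⟨x, hx⟩
    exact ⟨x, h.injective ((hab x).trans hx)⟩
  · rintro ⟨x, rfl⟩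
    exact ⟨x, (hab x).symm⟩

theorem isRearrangement_of_finite {n : ℕ} {ι : Type*} [Finite ι]
    (h : CantorCube n ≃ₜ CantorCube n) (D R : ι → Fin n → List Bool) (hD : IsCubePartition D)
    (hDR : ∀ j x, h (cubeMap (D j) x) = cubeMap (R j) x) : IsRearrangement h := by
  have hR : IsCubePartition R := by
    intro y
    obtain ⟨j, hj, hu⟩ := hD (h.symm y)
    refine ⟨j, ?_, fun j' hj' => hu j' ?_⟩
    · simpa using (mem_subcube_iff_of_map h _ _ (hDR j) (h.symm y)).2 hj
    · exact (mem_subcube_iff_of_map h _ _ (hDR j') (h.symm y)).1 (by simpa using hj')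
  let e := Finite.equivFin ι
  have tr : ∀ E : ι → Fin n → List Bool, IsCubePartition E →
      IsCubePartition (fun j => E (e.symm j)) := by
    intro E hE x
    obtain ⟨j, hj, hu⟩ := hE x
    refine ⟨e j, by simpa using hj, fun j' hj' => ?_⟩
    rw [← hu _ hj', Equiv.apply_symm_apply]
  exact ⟨Nat.card ι, _, _, tr D hD, tr R hR, fun j x => hDR _ x⟩

theorem isRearrangement_one {n : ℕ} : IsRearrangement (1 : CantorCube n ≃ₜ CantorCube n) :=
  isRearrangement_of_finite (ι := Unit) _ (fun _ _ => []) (fun _ _ => [])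
    (fun x => ⟨(), ⟨x, rfl⟩, fun _ _ => rfl⟩) (fun _ _ => rfl)

theorem IsRearrangement.inv {n : ℕ} {h : CantorCube n ≃ₜ CantorCube n} (hh : IsRearrangement h) :
    IsRearrangement h⁻¹ := by
  obtain ⟨k, D, R, hD, hR, hDR⟩ := hh
  refine ⟨k, R, D, hR, hD, fun j x => ?_⟩
  rw [← hDR]
  exact h.symm_apply_apply _

theorem IsRearrangement.mul {n : ℕ} {g f : CantorCube n ≃ₜ CantorCube n} (hg : IsRearrangement g)
    (hf : IsRearrangement f) : IsRearrangement (g * f) := by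
  obtain ⟨k, D, R, hD, -, hDR⟩ := hf
  obtain ⟨k', D', R', hD', -, hDR'⟩ := hg
  refine isRearrangement_of_finite
    (ι := {p : Fin k × Fin k' // ∃ x y, cubeMap (R p.1) x = cubeMap (D' p.2) y}) _
    (fun p i => D p.1.1 i ++ (D' p.1.2 i).drop (R p.1.1 i).length)
    (fun p i => R' p.1.2 i ++ (R p.1.1 i).drop (D' p.1.2 i).length) ?_ ?_
  · intro x
    obtain ⟨i, ⟨u, rfl⟩, hi⟩ := hD x
    obtain ⟨j, ⟨w, hw⟩, hj⟩ := hD' (f (cubeMap (D i) u))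
    have huw : cubeMap (R i) u = cubeMap (D' j) w := by rw [hw, hDR]
    obtain ⟨-, z, hz, -⟩ := cubeMap_overlap _ _ _ _ huw
    refine ⟨⟨(i, j), u, w, huw⟩, ⟨z, ?_⟩, ?_⟩
    · rw [cubeMap_append, ← hz]
    · rintro ⟨⟨i', j'⟩, u', w', h'⟩ ⟨z', hz'⟩
      obtain ⟨heq, -⟩ := cubeMap_overlap _ _ _ _ h'
      rw [cubeMap_append] at hz'
      have e1 : i' = i := hi i' ⟨_, hz'⟩
      have e2 : j' = j := by
        refine hj j' ⟨cubeMap (fun l => (R i' l).drop (D' j' l).length) z', ?_⟩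
        rw [← hz', hDR, ← cubeMap_append, ← cubeMap_append]
        exact congrArg (fun α => cubeMap α z') (funext fun l => (heq l).symm)
      subst e1 e2
      rfl
  · rintro ⟨⟨i, j⟩, u, w, h⟩ z
    obtain ⟨heq, -⟩ := cubeMap_overlap _ _ _ _ h
    change g (f _) = _
    rw [cubeMap_append, hDR, ← cubeMap_append, cubeMap_append (R' j), ← hDR', ← cubeMap_append]
    exact congrArg (fun α => g (cubeMap α z)) (funext heq)

/-- The Brin–Thompson group `nV`: the group, under composition, of all rearrangements of the
Cantor cube `({0,1}^ω)^n`. -/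
def BrinThompson (n : ℕ) : Subgroup (CantorCube n ≃ₜ CantorCube n) where
  carrier := {h | IsRearrangement h}
  one_mem' := isRearrangement_one
  mul_mem' := IsRearrangement.mul
  inv_mem' := IsRearrangement.inv

/-! ### Partitions of the Cantor cube -/

/-! The argument splits in two. First, embedding into `nV` passes to finite-index overgroups with
the same `n` (`groupEmbeds_brinThompson_of_finiteIndex`): cut the cube into one subcube per coset,
each a copy of the whole cube, and let `G` act by the induced action. Hence `n` depends only on
embedding `A_Γ` itself.

Second, `A_Γ` embeds by ping-pong (`exists_raag_embedding`). Each vertex owns a set of coordinates,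
disjoint for adjacent vertices and overlapping for non-adjacent ones. Its generator changes only
these coordinates, so the relators hold, and it sends everything outside a repelling subcube into an
attracting one (`exists_hyperbolic`). The subcubes of distinct non-adjacent vertices are disjoint,
so a nonempty reduced word moves a base point into the attracting subcube of its first letter
(`raagWord_smul_mem`) and acts nontrivially. -/

theorem mem_subcube_iff {n : ℕ} {α : Fin n → List Bool} {x : CantorCube n} :
    x ∈ subcube α ↔ ∀ i, x i ∈ Set.range (prependWord (α i)) := by
  constructor
  · rintro ⟨y, rfl⟩ i
    exact ⟨y i, rfl⟩
  · intro h
    choose y hy using h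
    exact ⟨y, funext hy⟩

theorem cubeMap_injective {n : ℕ} (α : Fin n → List Bool) : Function.Injective (cubeMap α) :=
  fun _ _ h => funext fun i => prependWord_injective (α i) (congrFun h i)

theorem cubeMap_append_mem {n : ℕ} (α β : Fin n → List Bool) (x : CantorCube n) :
    cubeMap (fun i => α i ++ β i) x ∈ subcube α := by
  rw [cubeMap_append]
  exact ⟨_, rfl⟩

theorem continuous_prependWord (a : List Bool) : Continuous (prependWord a) := by
  induction a with
  | nil => exact continuous_id
  | cons b a ih =>
    refine continuous_pi fun k => ?_
    cases k with
    | zero => exact continuous_const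
    | succ k => exact (continuous_apply k).comp ih

theorem continuous_cubeMap {n : ℕ} (α : Fin n → List Bool) : Continuous (cubeMap α) :=
  continuous_pi fun i => (continuous_prependWord (α i)).comp (continuous_apply i)

theorem prependWord_singleton_mem {b : Bool} {x : ℕ → Bool} :
    x ∈ Set.range (prependWord [b]) ↔ x 0 = b := by
  constructor
  · rintro ⟨y, rfl⟩
    rfl
  · rintro rfl
    exact ⟨fun k => x (k + 1), by funext k; cases k <;> rfl⟩

theorem prependWord_cons_mem {b : Bool} {a : List Bool} {x : ℕ → Bool} :
    x ∈ Set.range (prependWord (b :: a)) ↔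
      x 0 = b ∧ (fun k => x (k + 1)) ∈ Set.range (prependWord a) := by
  constructor
  · rintro ⟨y, rfl⟩
    exact ⟨rfl, y, rfl⟩
  · rintro ⟨rfl, y, hy⟩
    refine ⟨y, ?_⟩
    funext k
    cases k with
    | zero => rfl
    | succ k => exact congrFun hy k

theorem prependWord_pair_mem {b c : Bool} {x : ℕ → Bool} :
    x ∈ Set.range (prependWord [b, c]) ↔ x 0 = b ∧ x 1 = c := by
  rw [prependWord_cons_mem, prependWord_singleton_mem]

theorem IsCubePartition.comp_equiv {n : ℕ} {ι κ : Type*} {D : ι → Fin n → List Bool}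
    (hD : IsCubePartition D) (e : κ ≃ ι) : IsCubePartition fun k => D (e k) := by
  intro x
  obtain ⟨i, hi, hu⟩ := hD x
  exact ⟨e.symm i, by simpa using hi, fun k hk => by rw [← hu _ hk, e.symm_apply_apply]⟩

/-- Refining every cube of a partition gives a partition. -/
theorem IsCubePartition.sigma {n : ℕ} {ι : Type*} {κ : ι → Type*} {D : ι → Fin n → List Bool}
    (hD : IsCubePartition D) {E : ∀ i, κ i → Fin n → List Bool}
    (hE : ∀ i, IsCubePartition (E i)) :
    IsCubePartition fun p : Σ i, κ i => fun c => D p.1 c ++ E p.1 p.2 c := by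
  intro x
  obtain ⟨i, ⟨y, rfl⟩, hi⟩ := hD x
  obtain ⟨j, ⟨z, rfl⟩, hj⟩ := hE i y
  refine ⟨⟨i, j⟩, ⟨z, cubeMap_append _ _ _⟩, ?_⟩
  rintro ⟨i', j'⟩ ⟨z', hz'⟩
  rw [cubeMap_append] at hz'
  obtain rfl : i' = i := hi i' ⟨_, hz'⟩
  obtain rfl : j' = j := hj j' ⟨z', cubeMap_injective _ hz'⟩
  rfl

/-- Refining a single cube of a partition gives a partition. -/
theorem IsCubePartition.refine {n : ℕ} {ι κ : Type*} {D : ι → Fin n → List Bool}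
    (hD : IsCubePartition D) (i₀ : ι) {E : κ → Fin n → List Bool} (hE : IsCubePartition E) :
    IsCubePartition (Sum.elim (fun i : {i // i ≠ i₀} => D i)
      fun k c => D i₀ c ++ E k c) := by
  intro x
  obtain ⟨i, ⟨y, rfl⟩, hi⟩ := hD x
  by_cases h : i = i₀
  · subst h
    obtain ⟨j, ⟨z, rfl⟩, hj⟩ := hE y
    refine ⟨Sum.inr j, ⟨z, cubeMap_append _ _ _⟩, ?_⟩
    rintro (⟨i', h'⟩ | j') hx
    · exact absurd (hi i' hx) h'
    · obtain ⟨z', hz'⟩ := hx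
      simp only [Sum.elim_inr, cubeMap_append] at hz'
      rw [hj j' ⟨z', cubeMap_injective _ hz'⟩]
  · refine ⟨Sum.inl ⟨i, h⟩, ⟨y, rfl⟩, ?_⟩
    rintro (⟨i', h'⟩ | j') hx
    · obtain rfl : i' = i := hi i' hx
      rfl
    · obtain ⟨z', hz'⟩ := hx
      simp only [Sum.elim_inr, cubeMap_append] at hz'
      exact absurd (hi i₀ ⟨_, hz'⟩).symm h

/-- The Cantor cube is the disjoint union of the cubes of a finite partition. -/
noncomputable def IsCubePartition.homeo {n : ℕ} {ι : Type*} [Finite ι]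
    {D : ι → Fin n → List Bool} (hD : IsCubePartition D) :
    (Σ _ : ι, CantorCube n) ≃ₜ CantorCube n :=
  Continuous.homeoOfEquivCompactToT2
    (f := Equiv.ofBijective (fun p : Σ _ : ι, CantorCube n => cubeMap (D p.1) p.2) (by
      constructor
      · rintro ⟨i, x⟩ ⟨j, y⟩ h
        obtain ⟨k, -, hk⟩ := hD (cubeMap (D i) x)
        obtain rfl : i = j := (hk i ⟨x, rfl⟩).trans (hk j ⟨y, h.symm⟩).symm
        obtain rfl := cubeMap_injective _ h
        rfl
      · intro x
        obtain ⟨i, ⟨y, rfl⟩, -⟩ := hD x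
        exact ⟨⟨i, y⟩, rfl⟩))
    (continuous_sigma fun i => continuous_cubeMap (D i))

@[simp]
theorem IsCubePartition.homeo_apply {n : ℕ} {ι : Type*} [Finite ι] {D : ι → Fin n → List Bool}
    (hD : IsCubePartition D) (p : Σ _ : ι, CantorCube n) : hD.homeo p = cubeMap (D p.1) p.2 := rfl

@[simp]
theorem IsCubePartition.homeo_symm_cubeMap {n : ℕ} {ι : Type*} [Finite ι]
    {D : ι → Fin n → List Bool} (hD : IsCubePartition D) (i : ι) (x : CantorCube n) :
    hD.homeo.symm (cubeMap (D i) x) = ⟨i, x⟩ :=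
  hD.homeo.symm_apply_apply ⟨i, x⟩

/-- Prefix replacement between two partitions with the same index set. -/
theorem exists_brinThompson {n : ℕ} {ι : Type*} [Finite ι] {D R : ι → Fin n → List Bool}
    (hD : IsCubePartition D) (hR : IsCubePartition R) :
    ∃ h : BrinThompson n, ∀ j x, h.1 (cubeMap (D j) x) = cubeMap (R j) x := by
  have key : ∀ j x, (hD.homeo.symm.trans hR.homeo) (cubeMap (D j) x) = cubeMap (R j) x := by
    intro j x
    simp
  exact ⟨⟨_, isRearrangement_of_finite _ D R hD key⟩, key⟩

/-- There is a partition of the Cantor cube into any positive number of subcubes which constrain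
only one given coordinate. -/
theorem exists_isCubePartition {n : ℕ} (p : Fin n) (κ : Type*) [Finite κ] [Nonempty κ] :
    ∃ E : κ → Fin n → List Bool, IsCubePartition E ∧ ∀ k, ∀ c ≠ p, E k c = [] := by
  -- A comb of words: each new index gets `false`, and `true` is prepended to the old words. A
  -- single index gets the empty word.
  have words : ∀ κ : Type _, [Finite κ] → Nonempty κ →
      ∃ w : κ → List Bool, ∀ x : ℕ → Bool, ∃! k, x ∈ Set.range (prependWord (w k)) := by
    intro κ _
    induction κ using Finite.induction_empty_option with
    | of_equiv e ih =>
      intro h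
      obtain ⟨w, hw⟩ := ih (e.nonempty_congr.2 h)
      refine ⟨fun k => w (e.symm k), fun x => ?_⟩
      obtain ⟨k, hk, hu⟩ := hw x
      exact ⟨e k, by simpa using hk, fun j hj => by rw [← hu _ hj, e.apply_symm_apply]⟩
    | h_empty => exact fun h => h.elim fun x => x.elim
    | h_option ih =>
      rename_i κ _
      intro _
      rcases isEmpty_or_nonempty κ with hκ | hκ
      · refine ⟨fun _ => [], fun x => ⟨none, ⟨x, rfl⟩, ?_⟩⟩
        rintro (_ | k) -
        · rfl
        · exact hκ.elim k
      · obtain ⟨w, hw⟩ := ih hκ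
        refine ⟨fun o => o.elim [false] fun k => true :: w k, fun x => ?_⟩
        cases hx : x 0 with
        | false =>
          refine ⟨none, prependWord_singleton_mem.2 hx, ?_⟩
          rintro (_ | k) hk
          · rfl
          · have := (prependWord_cons_mem.1 hk).1
            simp [hx] at this
        | true =>
          obtain ⟨k, hk, hu⟩ := hw fun k => x (k + 1)
          refine ⟨some k, prependWord_cons_mem.2 ⟨hx, hk⟩, ?_⟩
          rintro (_ | j) hj
          · have := prependWord_singleton_mem.1 hj
            simp [hx] at this
          · rw [hu j (prependWord_cons_mem.1 hj).2]
  obtain ⟨w, hw⟩ := words κ inferInstance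
  refine ⟨fun k c => if c = p then w k else [], fun x => ?_, fun k c hc => if_neg hc⟩
  have hmem : ∀ k, x ∈ subcube (fun c => if c = p then w k else []) ↔
      x p ∈ Set.range (prependWord (w k)) := by
    intro k
    rw [mem_subcube_iff]
    constructor
    · intro h
      simpa using h p
    · intro h c
      by_cases hc : c = p
      · subst hc
        simpa using h
      · simpa [hc] using ⟨x c, rfl⟩
  simpa only [hmem] using hw (x p)

/-! ### Finite extensions -/

/-- A group with a finite-index subgroup `H` which embeds into `nV` embeds into `nV`: induce the
action of `H` to an action of `G` on a disjoint union of copies of the cube, one for each coset. -/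
theorem groupEmbeds_brinThompson_of_finiteIndex {n : ℕ} (p : Fin n) {G : Type*} [Group G]
    (H : Subgroup G) [H.FiniteIndex] (ψ : H →* BrinThompson n) (hψ : Function.Injective ψ) :
    GroupEmbeds G (BrinThompson n) := by
  obtain ⟨c, hc, -⟩ := exists_isCubePartition p (G ⧸ H)
  have hκ : ∀ (g : G) (q : G ⧸ H), (Quotient.out (g • q))⁻¹ * g * Quotient.out q ∈ H := by
    intro g q
    rw [mul_assoc, ← QuotientGroup.eq, QuotientGroup.out_eq', ← smul_eq_mul,
      ← MulAction.Quotient.smul_coe, QuotientGroup.out_eq']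
  -- The cocycle of the induced action: `g * out q = out (g • q) * κ g q`.
  let κ : G → G ⧸ H → H := fun g q => ⟨_, hκ g q⟩
  have κ_one : ∀ q, κ 1 q = 1 := fun q => Subtype.ext <| by simp [κ]
  have κ_mul : ∀ g g' q, κ (g * g') q = κ g (g' • q) * κ g' q := fun g g' q =>
    Subtype.ext <| by simp [κ, mul_smul, mul_assoc]
  let F : G → CantorCube n → CantorCube n := fun g x =>
    cubeMap (c (g • (hc.homeo.symm x).1)) ((ψ (κ g (hc.homeo.symm x).1)).1 (hc.homeo.symm x).2)
  have F_apply : ∀ g q x, F g (cubeMap (c q) x) = cubeMap (c (g • q)) ((ψ (κ g q)).1 x) := by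
    intro g q x
    simp [F]
  have F_one : ∀ x, F 1 x = x := by
    intro x
    obtain ⟨q, ⟨y, rfl⟩, -⟩ := hc x
    rw [F_apply, κ_one, map_one, one_smul]
    rfl
  have F_mul : ∀ g g' x, F (g * g') x = F g (F g' x) := by
    intro g g' x
    obtain ⟨q, ⟨y, rfl⟩, -⟩ := hc x
    rw [F_apply g' q y, F_apply (g * g') q y, F_apply g, κ_mul, map_mul, mul_smul]
    rfl
  have F_cont : ∀ g, Continuous (F g) := by
    intro g
    have : Continuous fun r : Σ _ : G ⧸ H, CantorCube n =>
        cubeMap (c (g • r.1)) ((ψ (κ g r.1)).1 r.2) :=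
      continuous_sigma fun q => (continuous_cubeMap (c (g • q))).comp (ψ (κ g q)).1.continuous
    exact this.comp hc.homeo.symm.continuous
  let Φ : G → CantorCube n ≃ₜ CantorCube n := fun g =>
    { toFun := F g
      invFun := F g⁻¹
      left_inv := fun x => by rw [← F_mul, inv_mul_cancel, F_one]
      right_inv := fun x => by rw [← F_mul, mul_inv_cancel, F_one]
      continuous_toFun := F_cont g
      continuous_invFun := F_cont g⁻¹ }
  have hΦ : ∀ g, IsRearrangement (Φ g) := by
    intro g
    choose k D R hD _ hDR using fun q => (ψ (κ g q)).2
    refine isRearrangement_of_finite (ι := Σ q, Fin (k q)) _ _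
      (fun r i => c (g • r.1) i ++ R r.1 r.2 i) (hc.sigma hD) ?_
    rintro ⟨q, j⟩ x
    rw [cubeMap_append, cubeMap_append, ← hDR]
    exact F_apply _ _ _
  refine ⟨MonoidHom.mk' (fun g => ⟨Φ g, hΦ g⟩) fun g g' => Subtype.ext <|
    Homeomorph.ext fun x => F_mul g g' x, ?_⟩
  rw [injective_iff_map_eq_one]
  intro g hg
  have hF : ∀ x, F g x = x := fun x => congrArg (fun h : BrinThompson n => h.1 x) hg
  have hq : ∀ q x, g • q = q ∧ (ψ (κ g q)).1 x = x := by
    intro q x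
    have h := congrArg hc.homeo.symm ((F_apply g q x).symm.trans (hF _))
    simpa using h
  -- Triviality on one coset suffices: `g` fixes `q`, so `κ g q = 1` exhibits a conjugate of `g` as
  -- trivial.
  let q : G ⧸ H := ((1 : G) : G ⧸ H)
  have h1 : κ g q = 1 := hψ <| by
    rw [map_one]
    exact Subtype.ext (Homeomorph.ext fun x => (hq q x).2)
  have h2 := congrArg Subtype.val h1
  simp only [κ, (hq q (fun _ _ => true)).1, OneMemClass.coe_one] at h2
  rw [mul_assoc, inv_mul_eq_one] at h2
  exact right_eq_mul.1 h2

/-! ### A ping-pong lemma for right-angled Artin groups -/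

/-- The generator `g_v` (for `true`) or its inverse (for `false`). -/
def raagLetter {V : Type*} (Γ : SimpleGraph V) (p : V × Bool) : RightAngledArtinGroup Γ :=
  if p.2 then PresentedGroup.of p.1 else (PresentedGroup.of p.1)⁻¹

/-- The element of the right-angled Artin group represented by a word. -/
def raagWord {V : Type*} (Γ : SimpleGraph V) (l : List (V × Bool)) : RightAngledArtinGroup Γ :=
  (l.map (raagLetter Γ)).prod

theorem raagWord_cons {V : Type*} (Γ : SimpleGraph V) (p : V × Bool) (l : List (V × Bool)) :
    raagWord Γ (p :: l) = raagLetter Γ p * raagWord Γ l := by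
  simp [raagWord]

theorem raagLetter_mul_not {V : Type*} (Γ : SimpleGraph V) (v : V) (b : Bool) :
    raagLetter Γ (v, !b) * raagLetter Γ (v, b) = 1 := by
  cases b <;> simp [raagLetter]

theorem raagLetter_commute {V : Type*} {Γ : SimpleGraph V} {p q : V × Bool}
    (h : Γ.Adj p.1 q.1) : Commute (raagLetter Γ p) (raagLetter Γ q) := by
  have key : Commute (PresentedGroup.of p.1 : RightAngledArtinGroup Γ)
      (PresentedGroup.of q.1) := by
    have h1 := PresentedGroup.one_of_mem (rels := raagRels Γ) ⟨p.1, q.1, h, rfl⟩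
    simp only [map_mul, map_inv] at h1
    rw [mul_inv_eq_one, mul_inv_eq_iff_eq_mul] at h1
    exact h1
  unfold raagLetter
  split_ifs <;> simpa using key

theorem raagWord_surjective {V : Type*} (Γ : SimpleGraph V) :
    Function.Surjective (raagWord Γ) := by
  intro g
  induction g using PresentedGroup.induction_on with
  | _ z =>
    induction z using FreeGroup.induction_on with
    | C1 => exact ⟨[], by simp [raagWord]⟩
    | of v => exact ⟨[(v, true)], by simp [raagWord, raagLetter]; rfl⟩
    | inv_of v _ => exact ⟨[(v, false)], by simp [raagWord, raagLetter]; rfl⟩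
    | mul a b ha hb =>
      obtain ⟨l, hl⟩ := ha
      obtain ⟨m, hm⟩ := hb
      exact ⟨l ++ m, by rw [map_mul, ← hl, ← hm]; simp [raagWord]⟩

/-- A word is reduced if no shorter word represents the same element. -/
def RaagReduced {V : Type*} (Γ : SimpleGraph V) (l : List (V × Bool)) : Prop :=
  ∀ m, raagWord Γ m = raagWord Γ l → l.length ≤ m.length

theorem exists_raagReduced {V : Type*} (Γ : SimpleGraph V) (g : RightAngledArtinGroup Γ) :
    ∃ l, raagWord Γ l = g ∧ RaagReduced Γ l := by
  obtain ⟨l, hl, hmin⟩ := exists_minimalFor_of_wellFoundedLT (fun l => raagWord Γ l = g)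
    List.length (raagWord_surjective Γ g)
  refine ⟨l, hl, fun m hm => ?_⟩
  by_contra h
  exact h (hmin (hm.trans hl) (by omega))

theorem RaagReduced.tail {V : Type*} {Γ : SimpleGraph V} {p : V × Bool} {l : List (V × Bool)}
    (h : RaagReduced Γ (p :: l)) : RaagReduced Γ l := by
  intro m hm
  have := h (p :: m) (by rw [raagWord_cons, raagWord_cons, hm])
  simpa using this

theorem RaagReduced.swap {V : Type*} {Γ : SimpleGraph V} {p q : V × Bool} {l : List (V × Bool)}
    (hpq : Γ.Adj p.1 q.1) (h : RaagReduced Γ (p :: q :: l)) :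
    raagWord Γ (p :: q :: l) = raagWord Γ (q :: p :: l) ∧ RaagReduced Γ (q :: p :: l) := by
  have heq : raagWord Γ (p :: q :: l) = raagWord Γ (q :: p :: l) := by
    simp only [raagWord_cons, ← mul_assoc, (raagLetter_commute hpq).eq]
  exact ⟨heq, fun m hm => h m (hm.trans heq.symm)⟩

/-- Ping-pong: under these hypotheses a reduced word with first letter `p` moves the base point
into `S p`. -/
theorem raagWord_smul_mem {V X : Type*} {Γ : SimpleGraph V}
    (φ : RightAngledArtinGroup Γ →* Equiv.Perm X) (S : V × Bool → Set X) (x : X)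
    (hself : ∀ p, ∀ y ∈ S p, φ (raagLetter Γ p) y ∈ S p)
    (hadj : ∀ p q, Γ.Adj p.1 q.1 → ∀ y ∈ S q, φ (raagLetter Γ p) y ∈ S q)
    (hnon : ∀ p q, p.1 ≠ q.1 → ¬ Γ.Adj p.1 q.1 → ∀ y ∈ S q, φ (raagLetter Γ p) y ∈ S p)
    (hbase : ∀ p, φ (raagLetter Γ p) x ∈ S p) :
    ∀ (l : List (V × Bool)) (p : V × Bool), RaagReduced Γ (p :: l) →
      φ (raagWord Γ (p :: l)) x ∈ S p := by
  intro l
  -- Induction on length, not structure: the adjacent case needs the claim for `p :: l`, which is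
  -- not a suffix of `p :: q :: l`.
  induction hn : l.length generalizing l with
  | zero =>
    obtain rfl := List.length_eq_zero_iff.1 hn
    intro p _
    simpa [raagWord] using hbase p
  | succ n ih =>
    intro p hp
    obtain ⟨q, l, rfl⟩ := List.exists_cons_of_length_eq_add_one hn
    replace hn : l.length = n := by simpa using hn
    have hq : φ (raagWord Γ (q :: l)) x ∈ S q := ih l hn q hp.tail
    by_cases hpq : p.1 = q.1
    · obtain ⟨v, a⟩ := p
      obtain ⟨w, b⟩ := q
      obtain rfl : v = w := hpq
      by_cases hab : a = b
      · subst hab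
        rw [raagWord_cons, map_mul]
        exact hself _ _ hq
      · obtain rfl : a = !b := by cases a <;> cases b <;> simp_all
        have := hp l (by simp only [raagWord_cons, ← mul_assoc, raagLetter_mul_not, one_mul])
        simp only [List.length_cons] at this
        omega
    -- When the letters commute, `p` can still be brought next to the shorter word, and `q`, applied
    -- last, preserves `S p`.
    by_cases h : Γ.Adj p.1 q.1
    · obtain ⟨heq, hred⟩ := hp.swap h
      rw [heq, raagWord_cons, map_mul]
      exact hadj _ _ h.symm _ (ih l hn p hred.tail)
    · rw [raagWord_cons, map_mul]
      exact hnon _ _ hpq h _ hq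

/-- A nontrivial element has a nonempty reduced word, which carries `x` into some `S p`; but `x`
lies in none of them. -/
theorem raag_injective_of_pingPong {V X : Type*} {Γ : SimpleGraph V}
    (φ : RightAngledArtinGroup Γ →* Equiv.Perm X) (S : V × Bool → Set X) (x : X)
    (hx : ∀ p, x ∉ S p)
    (hself : ∀ p, ∀ y ∈ S p, φ (raagLetter Γ p) y ∈ S p)
    (hadj : ∀ p q, Γ.Adj p.1 q.1 → ∀ y ∈ S q, φ (raagLetter Γ p) y ∈ S q)
    (hnon : ∀ p q, p.1 ≠ q.1 → ¬ Γ.Adj p.1 q.1 → ∀ y ∈ S q, φ (raagLetter Γ p) y ∈ S p)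
    (hbase : ∀ p, φ (raagLetter Γ p) x ∈ S p) : Function.Injective φ := by
  rw [injective_iff_map_eq_one]
  intro g hg
  obtain ⟨l, rfl, hl⟩ := exists_raagReduced Γ g
  cases l with
  | nil => simp [raagWord]
  | cons p l =>
    have := raagWord_smul_mem φ S x hself hadj hnon hbase l p hl
    rw [hg] at this
    exact absurd this (hx p)

/-! ### Elements of the Brin–Thompson group acting on a set of coordinates -/

/-- `h` fixes the coordinates outside `O`, and its effect on those in `O` depends only on them. -/
def ActsOnCoords {n : ℕ} (O : Set (Fin n)) (h : CantorCube n → CantorCube n) : Prop :=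
  (∀ x, ∀ c ∉ O, h x c = x c) ∧ ∀ x y, (∀ c ∈ O, x c = y c) → ∀ c ∈ O, h x c = h y c

/-- This is what makes the generators of adjacent vertices commute. -/
theorem ActsOnCoords.comm {n : ℕ} {O P : Set (Fin n)} {g h : CantorCube n → CantorCube n}
    (hOP : Disjoint O P) (hg : ActsOnCoords O g) (hh : ActsOnCoords P h) (x : CantorCube n) :
    g (h x) = h (g x) := by
  have aux : ∀ {O P : Set (Fin n)} {g h : CantorCube n → CantorCube n}, Disjoint O P →
      ActsOnCoords O g → ActsOnCoords P h → ∀ c ∈ O, g (h x) c = h (g x) c := by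
    intro O P g h hOP hg hh c hc
    rw [hh.1 _ c (Set.disjoint_left.1 hOP hc)]
    exact hg.2 _ _ (fun d hd => hh.1 _ d (Set.disjoint_left.1 hOP hd)) c hc
  funext c
  by_cases hO : c ∈ O
  · exact aux hOP hg hh c hO
  by_cases hP : c ∈ P
  · exact (aux hOP.symm hh hg c hP).symm
  · rw [hg.1 _ c hO, hh.1 _ c hP, hh.1 _ c hP, hg.1 _ c hO]

theorem mem_subcube_congr {n : ℕ} {O : Set (Fin n)} {α : Fin n → List Bool}
    (hα : ∀ c ∉ O, α c = []) {x y : CantorCube n} (hxy : ∀ c ∈ O, x c = y c)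
    (hx : x ∈ subcube α) : y ∈ subcube α := by
  rw [mem_subcube_iff] at hx ⊢
  intro c
  by_cases hc : c ∈ O
  · rw [← hxy c hc]
    exact hx c
  · rw [hα c hc]
    exact ⟨y c, rfl⟩

theorem ActsOnCoords.mem_subcube {n : ℕ} {O P : Set (Fin n)} {h : CantorCube n → CantorCube n}
    (hOP : Disjoint O P) (hh : ActsOnCoords O h) {α : Fin n → List Bool}
    (hα : ∀ c ∉ P, α c = []) {x : CantorCube n} (hx : x ∈ subcube α) : h x ∈ subcube α :=
  mem_subcube_congr hα (fun c hc => (hh.1 x c (Set.disjoint_right.1 hOP hc)).symm) hx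

theorem actsOnCoords_of_cubeMap {n : ℕ} {O : Set (Fin n)} {h : CantorCube n → CantorCube n}
    {ι : Type*} {D R : ι → Fin n → List Bool} (hD : IsCubePartition D)
    (hDO : ∀ j, ∀ c ∉ O, D j c = []) (hRO : ∀ j, ∀ c ∉ O, R j c = [])
    (hDR : ∀ j x, h (cubeMap (D j) x) = cubeMap (R j) x) : ActsOnCoords O h := by
  constructor
  · intro x c hc
    obtain ⟨j, ⟨y, rfl⟩, -⟩ := hD x
    rw [hDR]
    simp only [cubeMap, hDO j c hc, hRO j c hc]
  · intro x x' hxx' c hc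
    obtain ⟨j, ⟨y, rfl⟩, -⟩ := hD x
    obtain ⟨y', rfl⟩ := mem_subcube_congr (hDO j) hxx' ⟨y, rfl⟩
    rw [hDR, hDR]
    simp only [cubeMap]
    rw [prependWord_injective _ (hxx' c hc)]

/-- Cut each coordinate in `O` according to its first two digits. -/
noncomputable def twoBitCube {n : ℕ} (O : Set (Fin n)) (σ : O → Bool × Bool) (c : Fin n) :
    List Bool :=
  open Classical in if h : c ∈ O then [(σ ⟨c, h⟩).1, (σ ⟨c, h⟩).2] else []

theorem twoBitCube_of_notMem {n : ℕ} {O : Set (Fin n)} (σ : O → Bool × Bool) {c : Fin n}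
    (hc : c ∉ O) : twoBitCube O σ c = [] :=
  dif_neg hc

theorem mem_twoBitCube {n : ℕ} {O : Set (Fin n)} {σ : O → Bool × Bool} {x : CantorCube n} :
    x ∈ subcube (twoBitCube O σ) ↔ ∀ c : O, (x c 0, x c 1) = σ c := by
  rw [mem_subcube_iff]
  constructor
  · rintro h ⟨c, hc⟩
    have := h c
    rw [twoBitCube, dif_pos hc, prependWord_pair_mem] at this
    exact Prod.ext this.1 this.2
  · intro h c
    by_cases hc : c ∈ O
    · rw [twoBitCube, dif_pos hc, prependWord_pair_mem, ← h ⟨c, hc⟩]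
      exact ⟨rfl, rfl⟩
    · rw [twoBitCube_of_notMem σ hc]
      exact ⟨x c, rfl⟩

theorem isCubePartition_twoBitCube {n : ℕ} (O : Set (Fin n)) :
    IsCubePartition (twoBitCube O) := by
  intro x
  refine ⟨fun c => (x c 0, x c 1), mem_twoBitCube.2 fun _ => rfl, fun σ hσ => ?_⟩
  exact funext fun c => (mem_twoBitCube.1 hσ c).symm

/-- Two distinct cubes of a partition are the attracting and repelling regions of some element of
the Brin–Thompson group. -/
theorem exists_hyperbolic {n : ℕ} {O : Set (Fin n)} {p : Fin n} (hp : p ∈ O) {ι : Type*}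
    [Finite ι] {D : ι → Fin n → List Bool} (hD : IsCubePartition D)
    (hDO : ∀ i, ∀ c ∉ O, D i c = []) {i j : ι} (hij : i ≠ j) :
    ∃ h : BrinThompson n, ActsOnCoords O h.1 ∧ ActsOnCoords O (h⁻¹).1 ∧
      (∀ x ∉ subcube (D j), h.1 x ∈ subcube (D i)) ∧
      ∀ x ∉ subcube (D i), (h⁻¹).1 x ∈ subcube (D j) := by
  have : Nonempty {k // k ≠ j} := ⟨⟨i, hij⟩⟩
  have : Nonempty {k // k ≠ i} := ⟨⟨j, hij.symm⟩⟩
  obtain ⟨E, hE, hEp⟩ := exists_isCubePartition p {k // k ≠ j}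
  obtain ⟨F, hF, hFp⟩ := exists_isCubePartition p {k // k ≠ i}
  have hne : ∀ c ∉ O, c ≠ p := fun c hc h => hc (h ▸ hp)
  -- The element shrinks each `D k` with `k ≠ j` to the piece `E k` of `D i`, and expands the piece
  -- `F k` of `D j` onto `D k` for `k ≠ i`. The index sets of `E` and `F` are chosen so that the
  -- pieces match, after swapping the two summands.
  have hDj := hD.refine j hF
  have hDi := (hD.refine i hE).comp_equiv (Equiv.sumComm _ _)
  obtain ⟨h, hh⟩ := exists_brinThompson hDj hDi
  have hinv : ∀ k x, (h⁻¹).1 (cubeMap (Sum.elim (fun k : {k // k ≠ i} => D k)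
      (fun k c => D i c ++ E k c) (Equiv.sumComm _ _ k)) x) = cubeMap (Sum.elim
      (fun k : {k // k ≠ j} => D k) (fun k c => D j c ++ F k c) k) x := by
    intro k x
    rw [← hh]
    exact h.1.symm_apply_apply _
  have h1 : ∀ k, ∀ c ∉ O, Sum.elim (fun k : {k // k ≠ j} => D k)
      (fun k c => D j c ++ F k c) k c = [] := by
    rintro (k | k) c hc
    · exact hDO _ c hc
    · simp [hDO _ c hc, hFp k c (hne c hc)]
  have h2 : ∀ k, ∀ c ∉ O, Sum.elim (fun k : {k // k ≠ i} => D k)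
      (fun k c => D i c ++ E k c) (Equiv.sumComm _ _ k) c = [] := by
    rintro (k | k) c hc
    · simp [hDO _ c hc, hEp k c (hne c hc)]
    · exact hDO _ c hc
  refine ⟨h, actsOnCoords_of_cubeMap hDj h1 h2 hh, actsOnCoords_of_cubeMap hDi h2 h1 hinv,
    fun x hx => ?_, fun x hx => ?_⟩
  · obtain ⟨k, ⟨y, rfl⟩, -⟩ := hD x
    have hk : k ≠ j := by
      rintro rfl
      exact hx ⟨y, rfl⟩
    have := hh (Sum.inl ⟨k, hk⟩) y
    simp only [Sum.elim_inl] at this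
    rw [this]
    exact cubeMap_append_mem _ _ _
  · obtain ⟨k, ⟨y, rfl⟩, -⟩ := hD x
    have hk : k ≠ i := by
      rintro rfl
      exact hx ⟨y, rfl⟩
    have := hinv (Sum.inr ⟨k, hk⟩) y
    simp only [Equiv.sumComm_apply, Sum.swap_inr, Sum.elim_inl] at this
    rw [this]
    exact cubeMap_append_mem _ _ _

/-! ### Embedding right-angled Artin groups -/

/-- A right-angled Artin group embeds into `nV` if its generators can be given sets of coordinates,
each with a label on every one of its coordinates, such that adjacent vertices have disjoint sets
and distinct non-adjacent vertices have different labels on some common coordinate. -/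
theorem exists_raag_injective {V : Type*} {Γ : SimpleGraph V} {n : ℕ} (O : V → Set (Fin n))
    (lab : V → Fin n → Bool) (hO : ∀ v, ∃ c ∈ O v, lab v c = false)
    (hadj : ∀ v w, Γ.Adj v w → Disjoint (O v) (O w))
    (hnon : ∀ v w, v ≠ w → ¬ Γ.Adj v w → ∃ c, c ∈ O v ∧ c ∈ O w ∧ lab v c ≠ lab w c) :
    ∃ φ : RightAngledArtinGroup Γ →* BrinThompson n, Function.Injective φ := by
  -- The first digit, the label, separates non-adjacent vertices; the second separates attracting
  -- from repelling cubes of one vertex.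
  let A : V × Bool → Fin n → List Bool := fun p => twoBitCube (O p.1) fun c => (lab p.1 c, p.2)
  have hgen : ∀ v, ∃ h : BrinThompson n, ActsOnCoords (O v) h.1 ∧ ActsOnCoords (O v) (h⁻¹).1 ∧
      (∀ x ∉ subcube (A (v, false)), h.1 x ∈ subcube (A (v, true))) ∧
      ∀ x ∉ subcube (A (v, true)), (h⁻¹).1 x ∈ subcube (A (v, false)) := by
    intro v
    obtain ⟨c, hc, -⟩ := hO v
    refine exists_hyperbolic hc (isCubePartition_twoBitCube (O v))
      (fun σ d hd => twoBitCube_of_notMem σ hd) fun h => ?_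
    simpa using congrFun h ⟨c, hc⟩
  choose g hg hg' hpos hneg using hgen
  have hrel : ∀ r ∈ raagRels Γ, FreeGroup.lift g r = 1 := by
    rintro _ ⟨v, w, hvw, rfl⟩
    have : g v * g w = g w * g v :=
      Subtype.ext <| Homeomorph.ext fun x => (hg v).comm (hadj v w hvw) (hg w) x
    simp [this]
  let φ := PresentedGroup.toGroup hrel
  have hφ : ∀ v b, φ (raagLetter Γ (v, b)) = if b then g v else (g v)⁻¹ := by
    intro v b
    cases b <;> simp [raagLetter, φ]
  have hacts : ∀ p : V × Bool, ActsOnCoords (O p.1) (φ (raagLetter Γ p)).1 := by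
    rintro ⟨v, _ | _⟩ <;> rw [hφ]
    exacts [hg' v, hg v]
  have hping : ∀ (v : V) (b : Bool), ∀ x ∉ subcube (A (v, !b)),
      (φ (raagLetter Γ (v, b))).1 x ∈ subcube (A (v, b)) := by
    rintro v (_ | _) <;> rw [hφ]
    exacts [hneg v, hpos v]
  let toPerm : BrinThompson n →* Equiv.Perm (CantorCube n) :=
    MonoidHom.mk' (fun h => h.1.toEquiv) fun _ _ => rfl
  refine ⟨φ, Function.Injective.of_comp (f := toPerm) ?_⟩
  -- The all-`true` point avoids every `A p`, since each vertex has a coordinate labelled `false`.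
  refine raag_injective_of_pingPong (toPerm.comp φ) (fun p => subcube (A p)) (fun _ _ => true)
    ?_ ?_ ?_ ?_ ?_
  · intro p hp
    obtain ⟨c, hc, hlab⟩ := hO p.1
    have := mem_twoBitCube.1 hp ⟨c, hc⟩
    simp [hlab] at this
  · rintro ⟨v, b⟩ x hx
    refine hping v b x fun hx' => ?_
    obtain ⟨c, hc, -⟩ := hO v
    have := (mem_twoBitCube.1 hx ⟨c, hc⟩).symm.trans (mem_twoBitCube.1 hx' ⟨c, hc⟩)
    simp at this
  · intro p q hpq x hx
    exact (hacts p).mem_subcube (hadj _ _ hpq) (fun c hc => twoBitCube_of_notMem _ hc) hx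
  · rintro ⟨v, b⟩ ⟨w, b'⟩ hne hnadj x hx
    refine hping v b x fun hx' => ?_
    obtain ⟨c, hv, hw, hlab⟩ := hnon v w hne hnadj
    have := (mem_twoBitCube.1 hx ⟨c, hw⟩).symm.trans (mem_twoBitCube.1 hx' ⟨c, hv⟩)
    exact hlab (congrArg Prod.fst this).symm
  · rintro ⟨v, b⟩
    refine hping v b _ fun hx => ?_
    obtain ⟨c, hc, hlab⟩ := hO v
    have := mem_twoBitCube.1 hx ⟨c, hc⟩
    simp [hlab] at this

/-- One coordinate for each ordered pair `(a, b)`, owned by `a` and `b` when they are non-adjacent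
and by nobody otherwise. On it `a` has label `false` and any other owner has `true`. The diagonal
pair `(v, v)` gives each vertex a coordinate labelled `false`. -/
theorem exists_raag_embedding {V : Type*} [Finite V] (Γ : SimpleGraph V) :
    ∃ n : ℕ, 1 ≤ n ∧
      ∃ φ : RightAngledArtinGroup Γ →* BrinThompson n, Function.Injective φ := by
  classical
  -- The extra coordinate `none` keeps `n ≥ 1` when `V` is empty.
  let e := Finite.equivFin (Option (V × V))
  refine ⟨Nat.card (Option (V × V)), Nat.card_pos, exists_raag_injective
    (fun v => {c | ∃ a b, e.symm c = some (a, b) ∧ ¬ Γ.Adj a b ∧ (v = a ∨ v = b)})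
    (fun v c => decide (∀ b, e.symm c ≠ some (v, b))) ?_ ?_ ?_⟩
  · intro v
    exact ⟨e (some (v, v)), ⟨v, v, by simp⟩, by simp⟩
  · intro v w hvw
    rw [Set.disjoint_left]
    rintro c ⟨a, b, hc, hab, hv⟩ ⟨a', b', hc', -, hw⟩
    obtain ⟨rfl, rfl⟩ : a = a' ∧ b = b' := by simpa using hc.symm.trans hc'
    rcases hv with rfl | rfl <;> rcases hw with rfl | rfl
    · exact hvw.ne rfl
    · exact hab hvw
    · exact hab hvw.symm
    · exact hvw.ne rfl
  · intro v w hne hvw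
    exact ⟨e (some (v, w)), ⟨v, w, by simp [hvw]⟩, ⟨v, w, by simp [hvw]⟩, by simp [hne]⟩

theorem mainTheorem3 {V : Type*} [Finite V] (Γ : SimpleGraph V) :
    ∃ n : ℕ, 1 ≤ n ∧
      ∀ (G : Type*) [Group G],
        IsFiniteExtension (RightAngledArtinGroup Γ) G → GroupEmbeds G (BrinThompson n) := by
  obtain ⟨n, hn, φ, hφ⟩ := exists_raag_embedding Γ
  refine ⟨n, hn, fun G _ => ?_⟩
  rintro ⟨i, hi, hfin⟩
  let j := (MonoidHom.ofInjective hi).symm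
  exact groupEmbeds_brinThompson_of_finiteIndex ⟨0, hn⟩ i.range (φ.comp j.toMonoidHom)
    (hφ.comp j.injective)
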